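/- Let $q\in L^1_{\rm loc}(\mathbb R)$ be real-valued and even, and suppose that the differential expression $\tau_q(y)=-y''-qy$ on $\mathbb R$ is in the limit circle case at $+\infty$ and at $-\infty$ (i.e. for every $\lambda\in\mathbb C$ all solutions of $\tau_q(y)=\lambda y$ are square integrable near $+\infty$ and near $-\infty$). Let $\mathcal D_{\max}=\{y\in L^2(\mathbb R): y,y'\in AC_{\rm loc}(\mathbb R),\ \tau_q y\in L^2(\mathbb R)\}$, and let $A_{\max}y=\tau_q(y)$ for $y\in\mathcal D_{\max}$. Put $[f,g]_x=\overline{f(x)}g'(x)-\overline{f'(x)}g(x)$ and $[f,g]_{\pm\infty}=\lim_{x\to\pm\infty}[f,g]_x$. Let $w_1,w_2\in\mathcal D_{\max}$ be real-valued solutions of $\tau_q(y)=0$, $w_1$ odd and $w_2$ even, with $[w_1,w_2]_{-\infty}=[w_1,w_2]_{\infty}=1$, and for $f\in\mathcal D_{\max}$ put $\alpha_j(f)=[w_j,f]_{-\infty}$ and $\beta_j(f)=[w_j,f]_{\infty}$ ($j=1,2$). For $\xi,\eta\in\mathbb C$ with $|\xi|=|\eta|=1$ and $\alpha,\beta\in[0,2\pi)$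 let $\widetilde A=\widetilde A_{\xi,\eta,\alpha,\beta}$ be the restriction of $A_{\max}$ to $$\operatorname{dom}\widetilde A=\{f\in\mathcal D_{\max}:\ \alpha_1(f)\,\xi\cos\alpha-\alpha_2(f)\sin\alpha=0,\ \ \beta_1(f)\,\eta\cos\beta-\beta_2(f)\sin\beta=0\}$$ (separated boundary conditions). Let $(\mathcal Pf)(x)=f(-x)$ and $(\mathcal Tf)(x)=\overline{f(x)}$. A closed densely defined operator $H$ in $L^2(\mathbb R)$ is called $\mathcal{PT}$ symmetric if $\mathcal{PT}f\in\operatorname{dom}H$ and $\mathcal{PT}Hf=H\mathcal{PT}f$ for all $f\in\operatorname{dom}H$, and $\mathcal P$-self-adjoint if $H=\mathcal PH^*\mathcal P$ (including equality of domains). Different parameters may describe the same operator. Call the pair $(\xi,\alpha)$ normalized if $\xi\ne-1$, and $\xi=1$ whenever $\sin\alpha\cos\alpha=0$; similarly for $(\eta,\beta)$. Then: (1) Every $\widetilde A_{\xi,\eta,\alpha,\beta}$ is equal to some $\widetilde A_{\xi',\eta',\alpha',\beta'}$ with admissible parameters ($|\xi'|=|\eta'|=1$, $\alpha',\beta'\in[0,2\pi)$)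 for which $(\xi',\alpha')$ and $(\eta',\beta')$ are normalized. (2) If $(\xi,\alpha)$ and $(\eta,\beta)$ are normalized, then $\widetilde A$ is simultaneously $\mathcal{PT}$ symmetric, self-adjoint and $\mathcal P$-self-adjoint if and only if $\xi=\eta=1$ and $\alpha+\beta\equiv0\pmod\pi$. (3) For arbitrary admissible parameters, $\widetilde A$ is simultaneously $\mathcal{PT}$ symmetric, self-adjoint and $\mathcal P$-self-adjoint if and only if $\widetilde A=\widetilde A_{1,1,\alpha',\beta'}$ for some $\alpha',\beta'\in[0,2\pi)$ with $\alpha'+\beta'\equiv0\pmod\pi$. -/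

import Mathlib

open MeasureTheory Filter Topology

namespace PTQM

noncomputable section

/-- The Hilbert space `L²(ℝ)` of complex-valued functions. -/
abbrev L2 : Type := Lp ℂ 2 (volume : Measure ℝ)

/-! ### Parity, time reversal, and the three classes of operators -/

/-- The parity operator `(P f)(x) = f(-x)` on `L²(ℝ)`. -/
def parity (f : L2) : L2 :=
  Lp.compMeasurePreserving (fun x : ℝ => -x) (Measure.measurePreserving_neg volume) f

/-- The time reversal operator `(T f)(x) = conj (f x)` on `L²(ℝ)`. -/
def timeReversal (f : L2) : L2 := star f

theorem parity_ae (f : L2) : parity f =ᵐ[volume] fun x => f (-x) :=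
  Lp.coeFn_compMeasurePreserving f (Measure.measurePreserving_neg volume)

theorem timeReversal_ae (f : L2) :
    timeReversal f =ᵐ[volume] fun x => (starRingEnd ℂ) (f x) :=
  Lp.coeFn_star f

/-- `H` is closed and densely defined. -/
structure IsClosedDense (H : L2 →ₗ.[ℂ] L2) : Prop where
  closed : H.IsClosed
  dense : Dense (H.domain : Set L2)

/-- PT symmetry: for all `f ∈ dom H`, `P T f ∈ dom H` and `P T (H f) = H (P T f)`. -/
structure IsPTSymmetric (H : L2 →ₗ.[ℂ] L2) : Prop extends IsClosedDense H where
  comm : ∀ f : H.domain, ∃ h : parity (timeReversal (f : L2)) ∈ H.domain,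
    parity (timeReversal (H f)) = H ⟨parity (timeReversal (f : L2)), h⟩

/-- `P`-self-adjointness: `dom H = dom (H* P)` and `H f = P H* P f` for `f ∈ dom H`. -/
structure IsPSelfAdjoint (H : L2 →ₗ.[ℂ] L2) : Prop extends IsClosedDense H where
  mem_domain_iff : ∀ f : L2, f ∈ H.domain ↔ parity f ∈ H.adjoint.domain
  apply_eq : ∀ (f : H.domain) (h : parity (f : L2) ∈ H.adjoint.domain),
    H f = parity (H.adjoint ⟨parity (f : L2), h⟩)

/-! ### The differential expression and the maximal operator -/

/-- Absolute continuity on all compact intervals. -/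
def IsACLoc (y : ℝ → ℂ) : Prop := ∀ a b : ℝ, AbsolutelyContinuousOnInterval y a b

/-- `y` is differentiable, and `y` and `y'` are locally absolutely continuous; in particular
`y''` exists almost everywhere. -/
structure IsRegular (y : ℝ → ℂ) : Prop where
  differentiable : Differentiable ℝ y
  ac : IsACLoc y
  ac_deriv : IsACLoc (deriv y)

/-- The differential expression `τ_q y = -y'' - q y`. -/
def tau (q : ℝ → ℝ) (y : ℝ → ℂ) (x : ℝ) : ℂ := -(deriv (deriv y) x) - (q x : ℂ) * y x

/-- `y` solves `τ_q y = lam y` (in the almost everywhere sense). -/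
structure IsSolution (q : ℝ → ℝ) (lam : ℂ) (y : ℝ → ℂ) : Prop where
  regular : IsRegular y
  eqn : ∀ᵐ x : ℝ, tau q y x - lam * y x = 0

/-- `τ_q` is in the limit circle case at `+∞`. -/
def LimitCircleTop (q : ℝ → ℝ) : Prop :=
  ∀ (lam : ℂ) (y : ℝ → ℂ), IsSolution q lam y →
    ∃ a : ℝ, MemLp y 2 (volume.restrict (Set.Ioi a))

/-- `τ_q` is in the limit circle case at `-∞`. -/
def LimitCircleBot (q : ℝ → ℝ) : Prop :=
  ∀ (lam : ℂ) (y : ℝ → ℂ), IsSolution q lam y →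
    ∃ a : ℝ, MemLp y 2 (volume.restrict (Set.Iio a))

/-- The maximal domain: `y ∈ L²(ℝ)`, `y, y' ∈ AC_loc(ℝ)`, `τ_q y ∈ L²(ℝ)`. -/
structure InDmax (q : ℝ → ℝ) (y : ℝ → ℂ) : Prop where
  regular : IsRegular y
  memLp : MemLp y 2 volume
  memLp_tau : MemLp (tau q y) 2 volume

theorem IsACLoc.ae_differentiableAt {y : ℝ → ℂ} (h : IsACLoc y) :
    ∀ᵐ x : ℝ, DifferentiableAt ℝ y x := by
  refine LocallyBoundedVariationOn.ae_differentiableAt (f := y) ?_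
  intro a b _ _
  rw [Set.univ_inter]
  rcases le_total a b with hab | hab
  · rw [← Set.uIcc_of_le hab]
    exact (h a b).boundedVariationOn
  · exact (((h a a).boundedVariationOn).mono (by
      intro x hx
      have h1 : x = a := le_antisymm (hx.2.trans hab) hx.1
      simp [h1]))

theorem IsRegular.add {y z : ℝ → ℂ} (hy : IsRegular y) (hz : IsRegular z) :
    IsRegular (y + z) where
  differentiable := hy.differentiable.add hz.differentiable
  ac := fun a b => (hy.ac a b).add (hz.ac a b)
  ac_deriv := by
    have h : deriv (y + z) = deriv y + deriv z :=
      funext fun x => deriv_add (hy.differentiable x) (hz.differentiable x)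
    rw [h]
    exact fun a b => (hy.ac_deriv a b).add (hz.ac_deriv a b)

theorem IsRegular.smul {y : ℝ → ℂ} (c : ℂ) (hy : IsRegular y) : IsRegular (c • y) where
  differentiable := hy.differentiable.const_smul c
  ac := fun a b => (hy.ac a b).const_smul c
  ac_deriv := by
    have h : deriv (c • y) = fun x => c • deriv y x :=
      funext fun x => deriv_const_smul c (hy.differentiable x)
    rw [h]
    exact fun a b => (hy.ac_deriv a b).const_smul c

theorem tau_add {q : ℝ → ℝ} {y z : ℝ → ℂ} (hy : IsRegular y) (hz : IsRegular z) :
    tau q (y + z) =ᵐ[volume] tau q y + tau q z := by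
  have h : deriv (y + z) = deriv y + deriv z :=
    funext fun x => deriv_add (hy.differentiable x) (hz.differentiable x)
  filter_upwards [hy.ac_deriv.ae_differentiableAt, hz.ac_deriv.ae_differentiableAt]
    with x h1 h2
  simp only [tau, Pi.add_apply, h, deriv_add h1 h2]
  ring

theorem tau_smul {q : ℝ → ℝ} {y : ℝ → ℂ} (c : ℂ) (hy : IsRegular y) :
    tau q (c • y) =ᵐ[volume] c • tau q y := by
  have h : deriv (c • y) = c • deriv y :=
    funext fun x => deriv_const_smul c (hy.differentiable x)
  filter_upwards [hy.ac_deriv.ae_differentiableAt] with x h1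
  simp only [tau, Pi.smul_apply, h, deriv_const_smul c h1, smul_eq_mul]
  ring

theorem InDmax.add {q : ℝ → ℝ} {y z : ℝ → ℂ} (hy : InDmax q y) (hz : InDmax q z) :
    InDmax q (y + z) where
  regular := hy.regular.add hz.regular
  memLp := hy.memLp.add hz.memLp
  memLp_tau := (hy.memLp_tau.add hz.memLp_tau).ae_eq (tau_add hy.regular hz.regular).symm

theorem InDmax.smul {q : ℝ → ℝ} {y : ℝ → ℂ} (c : ℂ) (hy : InDmax q y) :
    InDmax q (c • y) where
  regular := hy.regular.smul c
  memLp := hy.memLp.const_smul c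
  memLp_tau := (hy.memLp_tau.const_smul c).ae_eq (tau_smul c hy.regular).symm

theorem inDmax_zero (q : ℝ → ℝ) : InDmax q 0 := by
  have h0 : deriv (0 : ℝ → ℂ) = 0 := by
    funext x
    exact deriv_const x (0 : ℂ)
  have hac : IsACLoc (0 : ℝ → ℂ) := by
    intro a b
    simpa [AbsolutelyContinuousOnInterval] using tendsto_const_nhds
  have ht : tau q 0 = 0 := by
    funext x
    simp only [tau, h0]
    simp
  exact ⟨⟨differentiable_const 0, hac, by rw [h0]; exact hac⟩, MemLp.zero,
    by rw [ht]; exact MemLp.zero⟩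

theorem IsRegular.eq_of_ae_eq {y z : ℝ → ℂ} (hy : IsRegular y) (hz : IsRegular z)
    (h : y =ᵐ[volume] z) : y = z :=
  (hy.differentiable.continuous.ae_eq_iff_eq volume hz.differentiable.continuous).1 h

/-- The domain of the maximal operator, as a subspace of `L²(ℝ)`. -/
def maxDomain (q : ℝ → ℝ) : Submodule ℂ L2 where
  carrier := {f | ∃ y : ℝ → ℂ, InDmax q y ∧ f =ᵐ[volume] y}
  add_mem' := by
    rintro f g ⟨y, hy, hfy⟩ ⟨z, hz, hgz⟩
    exact ⟨y + z, hy.add hz, (Lp.coeFn_add f g).trans (hfy.add hgz)⟩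
  zero_mem' := ⟨0, inDmax_zero q, Lp.coeFn_zero _ _ _⟩
  smul_mem' := by
    rintro c f ⟨y, hy, hfy⟩
    exact ⟨c • y, hy.smul c, (Lp.coeFn_smul c f).trans (hfy.const_smul c)⟩

/-- The unique continuously differentiable representative of an element of the maximal domain. -/
def rep {q : ℝ → ℝ} (f : maxDomain q) : ℝ → ℂ := Classical.choose f.2

theorem rep_inDmax {q : ℝ → ℝ} (f : maxDomain q) : InDmax q (rep f) :=
  (Classical.choose_spec f.2).1

theorem rep_ae {q : ℝ → ℝ} (f : maxDomain q) : (f : L2) =ᵐ[volume] rep f :=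
  (Classical.choose_spec f.2).2

theorem rep_eq {q : ℝ → ℝ} (f : maxDomain q) {y : ℝ → ℂ} (hy : IsRegular y)
    (h : (f : L2) =ᵐ[volume] y) : rep f = y :=
  (rep_inDmax f).regular.eq_of_ae_eq hy ((rep_ae f).symm.trans h)

theorem rep_add {q : ℝ → ℝ} (f g : maxDomain q) : rep (f + g) = rep f + rep g :=
  rep_eq _ ((rep_inDmax f).regular.add (rep_inDmax g).regular)
    ((Lp.coeFn_add (f : L2) (g : L2)).trans ((rep_ae f).add (rep_ae g)))

theorem rep_smul {q : ℝ → ℝ} (c : ℂ) (f : maxDomain q) : rep (c • f) = c • rep f :=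
  rep_eq _ ((rep_inDmax f).regular.smul c)
    ((Lp.coeFn_smul c (f : L2)).trans ((rep_ae f).const_smul c))

/-- The maximal operator `y ↦ τ_q y` on the maximal domain. -/
def maxOperator (q : ℝ → ℝ) : L2 →ₗ.[ℂ] L2 where
  domain := maxDomain q
  toFun :=
    { toFun := fun f => (rep_inDmax f).memLp_tau.toLp (tau q (rep f))
      map_add' := by
        intro f g
        rw [← MemLp.toLp_add]
        refine MemLp.toLp_congr _ _ ?_
        rw [rep_add]
        exact tau_add (rep_inDmax f).regular (rep_inDmax g).regular
      map_smul' := by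
        intro c f
        rw [RingHom.id_apply, ← MemLp.toLp_const_smul]
        refine MemLp.toLp_congr _ _ ?_
        rw [rep_smul]
        exact tau_smul c (rep_inDmax f).regular }

theorem maxOperator_ae {q : ℝ → ℝ} (f : (maxOperator q).domain) {y : ℝ → ℂ}
    (hy : InDmax q y) (h : (f : L2) =ᵐ[volume] y) :
    maxOperator q f =ᵐ[volume] tau q y := by
  have h1 : rep (q := q) f = y := rep_eq (q := q) f hy.regular h
  rw [← h1]
  exact MemLp.coeFn_toLp (rep_inDmax (q := q) f).memLp_tau

/-! ### Boundary values and separated boundary conditions -/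

/-- `[f, g]_x = conj (f x) g'(x) - conj (f'(x)) g(x)`. -/
def bracket (f g : ℝ → ℂ) (x : ℝ) : ℂ :=
  (starRingEnd ℂ) (f x) * deriv g x - (starRingEnd ℂ) (deriv f x) * g x

/-- `w₁` and `w₂` are real-valued solutions of `τ_q y = 0` in the maximal domain, `w₁` odd and
`w₂` even, with `[w₁, w₂]_{±∞} = 1`. -/
structure IsFundamentalPair (q : ℝ → ℝ) (w₁ w₂ : ℝ → ℂ) : Prop where
  dmax₁ : InDmax q w₁
  dmax₂ : InDmax q w₂
  sol₁ : IsSolution q 0 w₁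
  sol₂ : IsSolution q 0 w₂
  real₁ : ∀ x, (w₁ x).im = 0
  real₂ : ∀ x, (w₂ x).im = 0
  odd₁ : Function.Odd w₁
  even₂ : Function.Even w₂
  bracket_bot : Tendsto (bracket w₁ w₂) atBot (𝓝 1)
  bracket_top : Tendsto (bracket w₁ w₂) atTop (𝓝 1)

/-- The boundary values of `y` are `α₁(y) = [w₁, y]_{-∞} = a₁`, `α₂(y) = [w₂, y]_{-∞} = a₂`,
`β₁(y) = [w₁, y]_{∞} = b₁` and `β₂(y) = [w₂, y]_{∞} = b₂`. -/
structure HasBoundaryValues (w₁ w₂ y : ℝ → ℂ) (a₁ a₂ b₁ b₂ : ℂ) : Prop where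
  α₁ : Tendsto (bracket w₁ y) atBot (𝓝 a₁)
  α₂ : Tendsto (bracket w₂ y) atBot (𝓝 a₂)
  β₁ : Tendsto (bracket w₁ y) atTop (𝓝 b₁)
  β₂ : Tendsto (bracket w₂ y) atTop (𝓝 b₂)

/-- The separated boundary conditions
`α₁(y) ξ cos α - α₂(y) sin α = 0` and `β₁(y) η cos β - β₂(y) sin β = 0`. -/
def SeparatedBC (w₁ w₂ : ℝ → ℂ) (ξ η : ℂ) (α β : ℝ) (y : ℝ → ℂ) : Prop :=
  ∃ a₁ a₂ b₁ b₂ : ℂ, HasBoundaryValues w₁ w₂ y a₁ a₂ b₁ b₂ ∧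
    a₁ * ξ * (Real.cos α : ℂ) - a₂ * (Real.sin α : ℂ) = 0 ∧
    b₁ * η * (Real.cos β : ℂ) - b₂ * (Real.sin β : ℂ) = 0

theorem bracket_add (w : ℝ → ℂ) {y z : ℝ → ℂ} (hy : IsRegular y) (hz : IsRegular z) :
    bracket w (y + z) = fun x => bracket w y x + bracket w z x := by
  funext x
  simp only [bracket, Pi.add_apply, deriv_add (hy.differentiable x) (hz.differentiable x)]
  ring

theorem bracket_smul (w : ℝ → ℂ) {y : ℝ → ℂ} (c : ℂ) (hy : IsRegular y) :
    bracket w (c • y) = fun x => c * bracket w y x := by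
  funext x
  simp only [bracket, Pi.smul_apply, deriv_const_smul c (hy.differentiable x), smul_eq_mul]
  ring

/-- The elements of the maximal domain satisfying the separated boundary conditions. -/
def separatedDomain (q : ℝ → ℝ) (w₁ w₂ : ℝ → ℂ) (ξ η : ℂ) (α β : ℝ) : Submodule ℂ L2 where
  carrier := {f | ∃ y : ℝ → ℂ, InDmax q y ∧ f =ᵐ[volume] y ∧ SeparatedBC w₁ w₂ ξ η α β y}
  add_mem' := by
    rintro f g ⟨y, hy, hfy, a₁, a₂, b₁, b₂, hb, h1, h2⟩
      ⟨z, hz, hgz, a₁', a₂', b₁', b₂', hb', h1', h2'⟩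
    refine ⟨y + z, hy.add hz, (Lp.coeFn_add f g).trans (hfy.add hgz),
      a₁ + a₁', a₂ + a₂', b₁ + b₁', b₂ + b₂', ⟨?_, ?_, ?_, ?_⟩, ?_, ?_⟩
    · rw [bracket_add w₁ hy.regular hz.regular]
      exact hb.α₁.add hb'.α₁
    · rw [bracket_add w₂ hy.regular hz.regular]
      exact hb.α₂.add hb'.α₂
    · rw [bracket_add w₁ hy.regular hz.regular]
      exact hb.β₁.add hb'.β₁
    · rw [bracket_add w₂ hy.regular hz.regular]
      exact hb.β₂.add hb'.β₂
    · linear_combination h1 + h1'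
    · linear_combination h2 + h2'
  zero_mem' := by
    have h0 : ∀ w : ℝ → ℂ, bracket w 0 = fun _ => 0 := by
      intro w
      funext x
      have h : deriv (0 : ℝ → ℂ) x = 0 := deriv_const x (0 : ℂ)
      simp [bracket, h]
    refine ⟨0, inDmax_zero q, Lp.coeFn_zero _ _ _, 0, 0, 0, 0, ⟨?_, ?_, ?_, ?_⟩, by simp, by simp⟩
    all_goals
      rw [h0]
      exact tendsto_const_nhds
  smul_mem' := by
    rintro c f ⟨y, hy, hfy, a₁, a₂, b₁, b₂, hb, h1, h2⟩
    refine ⟨c • y, hy.smul c, (Lp.coeFn_smul c f).trans (hfy.const_smul c),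
      c * a₁, c * a₂, c * b₁, c * b₂, ⟨?_, ?_, ?_, ?_⟩, ?_, ?_⟩
    · rw [bracket_smul w₁ c hy.regular]
      exact hb.α₁.const_mul c
    · rw [bracket_smul w₂ c hy.regular]
      exact hb.α₂.const_mul c
    · rw [bracket_smul w₁ c hy.regular]
      exact hb.β₁.const_mul c
    · rw [bracket_smul w₂ c hy.regular]
      exact hb.β₂.const_mul c
    · linear_combination c * h1
    · linear_combination c * h2

/-- The restriction of the maximal operator to the functions that satisfy the separated boundary
conditions with parameters `ξ, η, α, β`. -/
def separatedExtension (q : ℝ → ℝ) (w₁ w₂ : ℝ → ℂ) (ξ η : ℂ) (α β : ℝ) : L2 →ₗ.[ℂ] L2 :=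
  (maxOperator q).domRestrict (separatedDomain q w₁ w₂ ξ η α β)

theorem mem_separatedExtension_domain {q : ℝ → ℝ} {w₁ w₂ : ℝ → ℂ} {ξ η : ℂ} {α β : ℝ} {f : L2} :
    f ∈ (separatedExtension q w₁ w₂ ξ η α β).domain ↔
      ∃ y : ℝ → ℂ, InDmax q y ∧ f =ᵐ[volume] y ∧ SeparatedBC w₁ w₂ ξ η α β y :=
  ⟨fun h => h.1, fun h => ⟨h, by obtain ⟨y, hy, hfy, -⟩ := h; exact ⟨y, hy, hfy⟩⟩⟩

/-- The pair `(ξ, α)` describes the condition `ξ cos α · z₁ = sin α · z₂` without sign ambiguity: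
`ξ ≠ -1` (as `(-1, α)` describes the same condition as `(1, -α)`), and `ξ = 1` if
`sin α cos α = 0` (where the condition does not depend on `ξ`). -/
def IsNormalized (ξ : ℂ) (α : ℝ) : Prop :=
  ξ ≠ -1 ∧ (Real.sin α * Real.cos α = 0 → ξ = 1)

end

end PTQM

namespace PTQM

open scoped ComplexConjugate

/-! ### Calculus of locally absolutely continuous functions -/

/-! Everything reduces to linear algebra on the boundary data `(a₁, a₂, b₁, b₂)`. The Wronskian of
`w₁, w₂` is identically `1`, so every bracket `[f, g]` is a 2×2 determinant in the brackets with
`w₁, w₂` (`bracket_eq`), and Lagrange's identity becomes Green's formula in boundary values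
(`green`).

Variation of parameters (`exists_tau_eq`) shows that all boundary data in `ℂ⁴` occur
(`exists_boundaryValues_eq`). It also shows that anything adjoint to `τ_q` on functions with zero
boundary values lies in the maximal domain (`exists_inDmax_of_forall_inner`). Hence the adjoint of a
separated extension is cut out by the annihilator of its boundary condition, which replaces `ξ, η`
by their conjugates (`adjoint_separatedExtension`).

Self-adjointness therefore forces `ξ` to be real when `sin α cos α ≠ 0`, so normalization gives `ξ =
1`, and likewise `η = 1`. By the parities of `w₁, w₂`, the operator `PT` acts on boundary data by
exchanging the two ends, conjugating, and changing the sign of the second component. For `ξ = η = 1`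
this preserves the conditions exactly when `sin (α + β) = 0`. In that case `P` preserves them too,
so self-adjointness yields `P`-self-adjointness. -/

theorem IsACLoc.continuous {f : ℝ → ℂ} (hf : IsACLoc f) : Continuous f := by
  refine continuous_iff_continuousAt.2 fun x => ?_
  refine (hf (x - 1) (x + 1)).continuousOn.continuousAt ?_
  rw [Set.uIcc_of_le (by linarith)]
  exact Icc_mem_nhds (by linarith) (by linarith)

theorem IsACLoc.mul {f g : ℝ → ℂ} (hf : IsACLoc f) (hg : IsACLoc g) :
    IsACLoc fun x => f x * g x :=
  fun a b => (hf a b).fun_smul (hg a b)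

theorem IsACLoc.sub {f g : ℝ → ℂ} (hf : IsACLoc f) (hg : IsACLoc g) :
    IsACLoc fun x => f x - g x :=
  fun a b => (hf a b).fun_sub (hg a b)

theorem isACLoc_const (c : ℂ) : IsACLoc fun _ => c :=
  fun _ _ => contDiffOn_const.absolutelyContinuousOnInterval

theorem IsACLoc.conj {f : ℝ → ℂ} (hf : IsACLoc f) : IsACLoc fun x => conj (f x) := by
  intro a b
  have h := hf a b
  unfold AbsolutelyContinuousOnInterval at h ⊢
  simpa only [Complex.dist_conj_conj] using h

theorem IsACLoc.comp_neg {f : ℝ → ℂ} (hf : IsACLoc f) : IsACLoc fun x => f (-x) := by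
  intro a b
  have h := hf (-a) (-b)
  rw [absolutelyContinuousOnInterval_iff] at h ⊢
  intro ε hε
  obtain ⟨δ, hδ, H⟩ := h ε hε
  refine ⟨δ, hδ, fun E hE hlen => H (E.1, fun i => (-(E.2 i).1, -(E.2 i).2)) ⟨?_, ?_⟩ ?_⟩
  · intro i hi
    have := hE.1 i hi
    simp only [Set.mem_uIcc] at this ⊢
    grind
  · intro i hi j hj hij
    have := hE.2 hi hj hij
    -- Reflection turns `(s, t]` into `[-t, -s)`, but disjointness of half-open intervals depends
    -- only on the endpoints, symmetrically under negation.
    simp only [Function.onFun, Set.uIoc, Set.Ioc_disjoint_Ioc] at this ⊢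
    grind
  · simpa only [dist_neg_neg] using hlen

theorem absolutelyContinuousOnInterval_ofReal {f : ℝ → ℝ} {a b : ℝ}
    (hf : AbsolutelyContinuousOnInterval f a b) :
    AbsolutelyContinuousOnInterval (fun x => (f x : ℂ)) a b := by
  unfold AbsolutelyContinuousOnInterval at hf ⊢
  simpa only [Complex.isometry_ofReal.dist_eq] using hf

theorem absolutelyContinuousOnInterval_primitive {g : ℝ → ℂ} {a b c : ℝ}
    (hg : IntervalIntegrable g volume a b) (hc : c ∈ Set.uIcc a b) :
    AbsolutelyContinuousOnInterval (fun x => ∫ t in c..x, g t) a b := by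
  have hre : IntervalIntegrable (fun t => (g t).re) volume a b := ⟨hg.1.re, hg.2.re⟩
  have him : IntervalIntegrable (fun t => (g t).im) volume a b := ⟨hg.1.im, hg.2.im⟩
  have h := (absolutelyContinuousOnInterval_ofReal
    (hre.absolutelyContinuousOnInterval_intervalIntegral hc)).fun_add
    ((absolutelyContinuousOnInterval_ofReal
      (him.absolutelyContinuousOnInterval_intervalIntegral hc)).const_smul Complex.I)
  have hsub : ∀ x ∈ Set.uIcc a b, (((∫ t in c..x, (g t).re : ℝ) : ℂ) +
      Complex.I • ((∫ t in c..x, (g t).im : ℝ) : ℂ)) = ∫ t in c..x, g t := by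
    intro x hx
    have hcx : IntervalIntegrable g volume c x := hg.mono_set (Set.uIcc_subset_uIcc hc hx)
    rw [← intervalIntegral.integral_ofReal, ← intervalIntegral.integral_ofReal,
      ← intervalIntegral.integral_smul, ← intervalIntegral.integral_add]
    · refine intervalIntegral.integral_congr fun t _ => ?_
      simp only [smul_eq_mul]
      rw [mul_comm, Complex.re_add_im]
    · exact ⟨hcx.1.re.ofReal, hcx.2.re.ofReal⟩
    · have him' : IntervalIntegrable (fun t => ((g t).im : ℂ)) volume c x :=
        ⟨hcx.1.im.ofReal, hcx.2.im.ofReal⟩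
      exact him'.smul Complex.I
  rw [absolutelyContinuousOnInterval_iff] at h ⊢
  intro ε hε
  obtain ⟨δ, hδ, H⟩ := h ε hε
  refine ⟨δ, hδ, fun E hE hlen => (H E hE hlen).trans_le' (le_of_eq ?_)⟩
  refine Finset.sum_congr rfl fun i hi => ?_
  rw [hsub _ (hE.1 i hi).1, hsub _ (hE.1 i hi).2]

theorem isACLoc_primitive {g : ℝ → ℂ} (hg : Integrable g) :
    IsACLoc fun x => ∫ t in (0 : ℝ)..x, g t := by
  intro a b
  -- The interval is enlarged to contain the base point `0`, then restricted again.
  refine (absolutelyContinuousOnInterval_primitive (a := min a (min b 0)) (b := max a (max b 0))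
    hg.intervalIntegrable ?_).mono ?_
  · rw [Set.mem_uIcc]; left; simp
  · refine Set.uIcc_subset_uIcc ?_ ?_ <;> (rw [Set.mem_uIcc]; left; simp)

/-- `F` minus the primitive of `g` is absolutely continuous with derivative zero almost everywhere,
hence constant. -/
theorem IsACLoc.intervalIntegral_eq_sub {F g : ℝ → ℂ} (hF : IsACLoc F) (a b : ℝ)
    (hg : IntervalIntegrable g volume a b) (h : ∀ᵐ x, HasDerivAt F (g x) x) :
    ∫ x in a..b, g x = F b - F a := by
  have hac := (hF a b).fun_sub (absolutelyContinuousOnInterval_primitive hg Set.left_mem_uIcc)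
  obtain ⟨C, hC⟩ := hac.const_of_ae_hasDerivAt_zero (by
    filter_upwards [h, hg.ae_hasDerivAt_integral] with x h1 h2 hx
    simpa using h1.fun_sub (h2 hx a Set.left_mem_uIcc))
  have h1 := hC a Set.left_mem_uIcc
  have h2 := hC b Set.right_mem_uIcc
  simp only [intervalIntegral.integral_same] at h1
  linear_combination h1 - h2

/-- Upgrades an almost everywhere derivative to a genuine one: `F` is a constant plus the primitive
of the continuous function `G`. In variation of parameters the coefficients are only absolutely
continuous, yet the solution must be differentiable everywhere. -/
theorem IsACLoc.hasDerivAt_of_ae {F G : ℝ → ℂ} (hF : IsACLoc F) (hG : Continuous G)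
    (h : ∀ᵐ x, HasDerivAt F (G x) x) (x : ℝ) : HasDerivAt F (G x) x := by
  have h1 : F = fun x => F 0 + ∫ t in (0 : ℝ)..x, G t := by
    funext x
    rw [hF.intervalIntegral_eq_sub 0 x (hG.intervalIntegrable _ _) h]
    ring
  rw [h1]
  exact (intervalIntegral.integral_hasDerivAt_right (hG.intervalIntegrable _ _)
    (hG.stronglyMeasurableAtFilter _ _) hG.continuousAt).const_add _

/-! ### Lagrange's identity -/

theorem hasDerivAt_conj {f : ℝ → ℂ} {f' : ℂ} {x : ℝ} (hf : HasDerivAt f f' x) :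
    HasDerivAt (fun t => conj (f t)) (conj f') x :=
  hf.star

theorem IsRegular.isACLoc_bracket {f g : ℝ → ℂ} (hf : IsRegular f) (hg : IsRegular g) :
    IsACLoc (bracket f g) :=
  (hf.ac.conj.mul hg.ac_deriv).sub (hf.ac_deriv.conj.mul hg.ac)

theorem IsRegular.ae_hasDerivAt_bracket (q : ℝ → ℝ) {f g : ℝ → ℂ} (hf : IsRegular f)
    (hg : IsRegular g) :
    ∀ᵐ x, HasDerivAt (bracket f g) (conj (tau q f x) * g x - conj (f x) * tau q g x) x := by
  filter_upwards [hf.ac_deriv.ae_differentiableAt, hg.ac_deriv.ae_differentiableAt] with x h1 h2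
  have h := ((hasDerivAt_conj (hf.differentiable x).hasDerivAt).mul h2.hasDerivAt).sub
    ((hasDerivAt_conj h1.hasDerivAt).mul (hg.differentiable x).hasDerivAt)
  refine h.congr_deriv ?_
  simp only [tau, map_sub, map_neg, map_mul, Complex.conj_ofReal]
  ring

theorem memLp_conj {f : ℝ → ℂ} (hf : MemLp f 2 volume) :
    MemLp (fun x => conj (f x)) 2 volume :=
  hf.star

theorem integrable_conj_mul {f g : ℝ → ℂ} (hf : MemLp f 2 volume) (hg : MemLp g 2 volume) :
    Integrable fun x => conj (f x) * g x :=
  (memLp_conj hf).integrable_mul hg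

theorem InDmax.integrable_lagrange {q : ℝ → ℝ} {f g : ℝ → ℂ} (hf : InDmax q f)
    (hg : InDmax q g) :
    Integrable fun x => conj (tau q f x) * g x - conj (f x) * tau q g x :=
  (integrable_conj_mul hf.memLp_tau hg.memLp).sub (integrable_conj_mul hf.memLp hg.memLp_tau)

theorem InDmax.bracket_sub {q : ℝ → ℝ} {f g : ℝ → ℂ} (hf : InDmax q f) (hg : InDmax q g)
    (a b : ℝ) :
    ∫ x in a..b, (conj (tau q f x) * g x - conj (f x) * tau q g x) =
      bracket f g b - bracket f g a :=
  (hf.regular.isACLoc_bracket hg.regular).intervalIntegral_eq_sub a b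
    (hf.integrable_lagrange hg).intervalIntegrable
    (hf.regular.ae_hasDerivAt_bracket q hg.regular)

theorem InDmax.tendsto_bracket_atTop {q : ℝ → ℝ} {f g : ℝ → ℂ} (hf : InDmax q f)
    (hg : InDmax q g) : ∃ l, Tendsto (bracket f g) atTop (𝓝 l) := by
  have h := (intervalIntegral_tendsto_integral_Ioi 0
    (hf.integrable_lagrange hg).integrableOn tendsto_id).add_const (bracket f g 0)
  refine ⟨_, h.congr fun x => ?_⟩
  rw [hf.bracket_sub hg]
  simp

theorem InDmax.tendsto_bracket_atBot {q : ℝ → ℝ} {f g : ℝ → ℂ} (hf : InDmax q f)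
    (hg : InDmax q g) : ∃ l, Tendsto (bracket f g) atBot (𝓝 l) := by
  have h := (intervalIntegral_tendsto_integral_Iic 0
    (hf.integrable_lagrange hg).integrableOn tendsto_id).const_sub (bracket f g 0)
  refine ⟨_, h.congr fun x => ?_⟩
  rw [hf.bracket_sub hg]
  simp

theorem InDmax.integral_lagrange {q : ℝ → ℝ} {f g : ℝ → ℂ} (hf : InDmax q f)
    (hg : InDmax q g) {l m : ℂ} (hl : Tendsto (bracket f g) atBot (𝓝 l))
    (hm : Tendsto (bracket f g) atTop (𝓝 m)) :
    (∫ x, conj (tau q f x) * g x) - ∫ x, conj (f x) * tau q g x = m - l := by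
  rw [← integral_sub (integrable_conj_mul hf.memLp_tau hg.memLp)
    (integrable_conj_mul hf.memLp hg.memLp_tau)]
  -- The integral over the line is the limit of the integrals over `[-x, x]`, each of which is a
  -- difference of brackets.
  have h1 := intervalIntegral_tendsto_integral (hf.integrable_lagrange hg)
    (tendsto_neg_atTop_atBot (G := ℝ)) tendsto_id
  have h2 := hm.sub (hl.comp (tendsto_neg_atTop_atBot (G := ℝ)))
  refine tendsto_nhds_unique h1 (h2.congr fun x => ?_)
  rw [hf.bracket_sub hg]
  rfl

/-! ### The fundamental pair -/

theorem IsSolution.tau_ae_eq_zero {q : ℝ → ℝ} {w : ℝ → ℂ} (h : IsSolution q 0 w) :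
    tau q w =ᵐ[volume] 0 := by
  filter_upwards [h.eqn] with x hx
  simpa using hx

theorem conj_eq_of_real {w : ℝ → ℂ} (h : ∀ x, (w x).im = 0) (x : ℝ) : conj (w x) = w x :=
  Complex.conj_eq_iff_im.2 (h x)

theorem IsRegular.conj_deriv_of_real {w : ℝ → ℂ} (hw : IsRegular w) (h : ∀ x, (w x).im = 0)
    (x : ℝ) : conj (deriv w x) = deriv w x := by
  have h1 := hasDerivAt_conj (hw.differentiable x).hasDerivAt
  simp only [conj_eq_of_real h] at h1
  exact h1.unique (hw.differentiable x).hasDerivAt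

namespace IsFundamentalPair

variable {q : ℝ → ℝ} {w₁ w₂ : ℝ → ℂ}

theorem bracket₁ (hw : IsFundamentalPair q w₁ w₂) (g : ℝ → ℂ) (x : ℝ) :
    bracket w₁ g x = w₁ x * deriv g x - deriv w₁ x * g x := by
  rw [bracket, conj_eq_of_real hw.real₁, hw.dmax₁.regular.conj_deriv_of_real hw.real₁]

theorem bracket₂ (hw : IsFundamentalPair q w₁ w₂) (g : ℝ → ℂ) (x : ℝ) :
    bracket w₂ g x = w₂ x * deriv g x - deriv w₂ x * g x := by
  rw [bracket, conj_eq_of_real hw.real₂, hw.dmax₂.regular.conj_deriv_of_real hw.real₂]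

theorem bracket_eq_one (hw : IsFundamentalPair q w₁ w₂) (x : ℝ) : bracket w₁ w₂ x = 1 := by
  have h0 : ∀ a b, bracket w₁ w₂ b - bracket w₁ w₂ a = 0 := by
    intro a b
    rw [← hw.dmax₁.bracket_sub hw.dmax₂]
    refine intervalIntegral.integral_zero_ae ?_
    filter_upwards [hw.sol₁.tau_ae_eq_zero, hw.sol₂.tau_ae_eq_zero] with x h1 h2 _
    simp [h1, h2]
  have h1 : bracket w₁ w₂ = fun _ => bracket w₁ w₂ x :=
    funext fun t => sub_eq_zero.1 (h0 x t)
  have h2 := hw.bracket_top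
  rw [h1] at h2
  exact tendsto_nhds_unique tendsto_const_nhds h2

theorem wronskian (hw : IsFundamentalPair q w₁ w₂) (x : ℝ) :
    w₁ x * deriv w₂ x - deriv w₁ x * w₂ x = 1 := by
  rw [← hw.bracket₁, hw.bracket_eq_one]

/-- The Plücker identity for 2×2 determinants, divided by the Wronskian, which is `1`. -/
theorem bracket_eq (hw : IsFundamentalPair q w₁ w₂) (f g : ℝ → ℂ) (x : ℝ) :
    bracket f g x =
      conj (bracket w₁ f x) * bracket w₂ g x - conj (bracket w₂ f x) * bracket w₁ g x := by
  have hW := hw.wronskian x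
  simp only [hw.bracket₁, hw.bracket₂, map_sub, map_mul, conj_eq_of_real hw.real₁,
    conj_eq_of_real hw.real₂, hw.dmax₁.regular.conj_deriv_of_real hw.real₁,
    hw.dmax₂.regular.conj_deriv_of_real hw.real₂]
  rw [bracket]
  linear_combination (-(conj (f x) * deriv g x - conj (deriv f x) * g x)) * hW

theorem exists_boundaryValues (hw : IsFundamentalPair q w₁ w₂) {y : ℝ → ℂ} (hy : InDmax q y) :
    ∃ a₁ a₂ b₁ b₂, HasBoundaryValues w₁ w₂ y a₁ a₂ b₁ b₂ := by
  obtain ⟨a₁, h1⟩ := hw.dmax₁.tendsto_bracket_atBot hy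
  obtain ⟨a₂, h2⟩ := hw.dmax₂.tendsto_bracket_atBot hy
  obtain ⟨b₁, h3⟩ := hw.dmax₁.tendsto_bracket_atTop hy
  obtain ⟨b₂, h4⟩ := hw.dmax₂.tendsto_bracket_atTop hy
  exact ⟨a₁, a₂, b₁, b₂, h1, h2, h3, h4⟩

/-- Green's formula in terms of boundary values. -/
theorem green (hw : IsFundamentalPair q w₁ w₂) {f g : ℝ → ℂ} (hf : InDmax q f)
    (hg : InDmax q g) {a₁ a₂ b₁ b₂ c₁ c₂ d₁ d₂ : ℂ} (hbf : HasBoundaryValues w₁ w₂ f a₁ a₂ b₁ b₂)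
    (hbg : HasBoundaryValues w₁ w₂ g c₁ c₂ d₁ d₂) :
    (∫ x, conj (tau q f x) * g x) - ∫ x, conj (f x) * tau q g x =
      (conj b₁ * d₂ - conj b₂ * d₁) - (conj a₁ * c₂ - conj a₂ * c₁) := by
  have hc : ∀ {l : Filter ℝ} {u v : ℝ → ℂ} {a c : ℂ}, Tendsto u l (𝓝 a) → Tendsto v l (𝓝 c) →
      Tendsto (fun x => conj (u x) * v x) l (𝓝 (conj a * c)) := fun hu hv =>
    ((Complex.continuous_conj.tendsto _).comp hu).mul hv
  refine hf.integral_lagrange hg ?_ ?_ <;> rw [funext (hw.bracket_eq f g)]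
  · exact (hc hbf.α₁ hbg.α₂).sub (hc hbf.α₂ hbg.α₁)
  · exact (hc hbf.β₁ hbg.β₂).sub (hc hbf.β₂ hbg.β₁)

end IsFundamentalPair

theorem HasBoundaryValues.unique {w₁ w₂ y : ℝ → ℂ} {a₁ a₂ b₁ b₂ c₁ c₂ d₁ d₂ : ℂ}
    (h : HasBoundaryValues w₁ w₂ y a₁ a₂ b₁ b₂) (h' : HasBoundaryValues w₁ w₂ y c₁ c₂ d₁ d₂) :
    a₁ = c₁ ∧ a₂ = c₂ ∧ b₁ = d₁ ∧ b₂ = d₂ :=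
  ⟨tendsto_nhds_unique h.α₁ h'.α₁, tendsto_nhds_unique h.α₂ h'.α₂,
    tendsto_nhds_unique h.β₁ h'.β₁, tendsto_nhds_unique h.β₂ h'.β₂⟩

/-! ### Surjectivity of the maximal operator and of the boundary values -/

/-- Supplies the coefficients for variation of parameters, with `g = w_j u`. Integrability of `g`
gives both the bound and the limits at the two ends. -/
theorem exists_primitive {g : ℝ → ℂ} (hg : Integrable g) (a : ℂ) :
    ∃ B : ℝ → ℂ, IsACLoc B ∧ (∀ᵐ x, HasDerivAt B (-g x) x) ∧ (∃ C, ∀ x, ‖B x‖ ≤ C) ∧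
      Tendsto B atBot (𝓝 a) ∧ Tendsto B atTop (𝓝 (a - ∫ x, g x)) := by
  have hbound : ∀ x, ‖∫ t in (0 : ℝ)..x, g t‖ ≤ ∫ t, ‖g t‖ := fun x =>
    (intervalIntegral.norm_integral_le_integral_norm_uIoc).trans
      (setIntegral_le_integral hg.norm (Eventually.of_forall fun _ => norm_nonneg _))
  refine ⟨fun x => (a - ∫ t in Set.Iic (0 : ℝ), g t) - ∫ t in (0 : ℝ)..x, g t,
    (isACLoc_const _).sub (isACLoc_primitive hg), ?_,
    ⟨‖a - ∫ t in Set.Iic (0 : ℝ), g t‖ + ∫ t, ‖g t‖, fun x =>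
      (norm_sub_le _ _).trans (add_le_add_right (hbound x) _)⟩, ?_, ?_⟩
  · filter_upwards [LocallyIntegrable.ae_hasDerivAt_integral hg.locallyIntegrable] with x hx
    exact (hx 0).const_sub _
  · have h := (intervalIntegral_tendsto_integral_Iic 0 hg.integrableOn
      tendsto_id).const_add (a - ∫ t in Set.Iic (0 : ℝ), g t)
    rw [sub_add_cancel] at h
    refine h.congr fun x => ?_
    rw [intervalIntegral.integral_symm x 0]
    simp
  · have h := (intervalIntegral_tendsto_integral_Ioi 0 hg.integrableOn
      tendsto_id).const_sub (a - ∫ t in Set.Iic (0 : ℝ), g t)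
    rw [sub_sub, intervalIntegral.integral_Iic_add_Ioi hg.integrableOn hg.integrableOn] at h
    exact h

theorem memLp_mul_bounded {w B : ℝ → ℂ} (hw : MemLp w 2 volume) (hB : Continuous B)
    (hC : ∃ C, ∀ x, ‖B x‖ ≤ C) : MemLp (fun x => w x * B x) 2 volume := by
  obtain ⟨C, hC⟩ := hC
  refine hw.of_le_mul (c := C) (hw.1.mul hB.aestronglyMeasurable)
    (Eventually.of_forall fun x => ?_)
  rw [norm_mul, mul_comm]
  exact mul_le_mul_of_nonneg_right (hC x) (norm_nonneg _)

theorem inner_eq_integral {f g : L2} {y z : ℝ → ℂ} (hf : f =ᵐ[volume] y)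
    (hg : g =ᵐ[volume] z) : inner ℂ f g = ∫ x, conj (y x) * z x := by
  rw [L2.inner_def]
  refine integral_congr_ae ?_
  filter_upwards [hf, hg] with x h1 h2
  rw [h1, h2, RCLike.inner_apply, mul_comm]

namespace IsFundamentalPair

variable {q : ℝ → ℝ} {w₁ w₂ : ℝ → ℂ}

/-- Variation of parameters: the equation `τ_q y = u` is solvable in the maximal domain with
prescribed boundary values at `-∞`. -/
theorem exists_tau_eq (hw : IsFundamentalPair q w₁ w₂) {u : ℝ → ℂ} (hu : MemLp u 2 volume)
    (a₁ a₂ : ℂ) :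
    ∃ y, InDmax q y ∧ tau q y =ᵐ[volume] u ∧
      HasBoundaryValues w₁ w₂ y a₁ a₂ (a₁ - ∫ x, w₁ x * u x) (a₂ - ∫ x, w₂ x * u x) := by
  obtain ⟨B₁, hac₁, hd₁, hb₁, hbot₁, htop₁⟩ :=
    exists_primitive (hw.dmax₁.memLp.integrable_mul hu) a₁
  obtain ⟨B₂, hac₂, hd₂, hb₂, hbot₂, htop₂⟩ :=
    exists_primitive (hw.dmax₂.memLp.integrable_mul hu) a₂
  have hr₁ := hw.dmax₁.regular
  have hr₂ := hw.dmax₂.regular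
  -- The ansatz is `y = w₂ B₁ - w₁ B₂` with `B_j' = -w_j u`. The terms containing `B_j'` cancel in
  -- `y'`, and since the Wronskian is `1` the coefficients are the brackets: `B_j = [w_j, y]`.
  have hac : IsACLoc fun x => w₂ x * B₁ x - w₁ x * B₂ x :=
    (hr₂.ac.mul hac₁).sub (hr₁.ac.mul hac₂)
  have hac' : IsACLoc fun x => deriv w₂ x * B₁ x - deriv w₁ x * B₂ x :=
    (hr₂.ac_deriv.mul hac₁).sub (hr₁.ac_deriv.mul hac₂)
  have hder : ∀ x, HasDerivAt (fun x => w₂ x * B₁ x - w₁ x * B₂ x)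
      (deriv w₂ x * B₁ x - deriv w₁ x * B₂ x) x := by
    refine hac.hasDerivAt_of_ae hac'.continuous ?_
    filter_upwards [hd₁, hd₂] with x h1 h2
    refine (((hr₂.differentiable x).hasDerivAt.mul h1).sub
      ((hr₁.differentiable x).hasDerivAt.mul h2)).congr_deriv ?_
    simp only [Pi.mul_apply]
    ring
  have hderiv : deriv (fun x => w₂ x * B₁ x - w₁ x * B₂ x) =
      fun x => deriv w₂ x * B₁ x - deriv w₁ x * B₂ x := funext fun x => (hder x).deriv
  have htau : tau q (fun x => w₂ x * B₁ x - w₁ x * B₂ x) =ᵐ[volume] u := by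
    filter_upwards [hd₁, hd₂, hr₁.ac_deriv.ae_differentiableAt,
      hr₂.ac_deriv.ae_differentiableAt, hw.sol₁.tau_ae_eq_zero, hw.sol₂.tau_ae_eq_zero]
      with x h1 h2 h3 h4 h5 h6
    have h := (h4.hasDerivAt.mul h1).sub (h3.hasDerivAt.mul h2)
    simp only [Pi.zero_apply, tau, Pi.mul_apply] at h5 h6 h ⊢
    rw [hderiv]
    have h' : deriv (fun x => deriv w₂ x * B₁ x - deriv w₁ x * B₂ x) x = _ := h.deriv
    rw [h']
    linear_combination B₁ x * h6 - B₂ x * h5 + u x * hw.wronskian x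
  have hbr₁ : bracket w₁ (fun x => w₂ x * B₁ x - w₁ x * B₂ x) = B₁ := by
    funext x
    rw [hw.bracket₁, hderiv]
    linear_combination B₁ x * hw.wronskian x
  have hbr₂ : bracket w₂ (fun x => w₂ x * B₁ x - w₁ x * B₂ x) = B₂ := by
    funext x
    rw [hw.bracket₂, hderiv]
    linear_combination B₂ x * hw.wronskian x
  refine ⟨_, ⟨⟨fun x => (hder x).differentiableAt, hac, by rwa [hderiv]⟩, ?_,
    hu.ae_eq htau.symm⟩, htau, ?_⟩
  · exact (memLp_mul_bounded hw.dmax₂.memLp hac₁.continuous hb₁).sub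
      (memLp_mul_bounded hw.dmax₁.memLp hac₂.continuous hb₂)
  · exact ⟨by rwa [hbr₁], by rwa [hbr₂], by rwa [hbr₁], by rwa [hbr₂]⟩

/-- The integrand is odd. -/
theorem integral_mul_eq_zero (hw : IsFundamentalPair q w₁ w₂) : ∫ x, w₁ x * w₂ x = 0 := by
  have h := integral_neg_eq_self (fun x => w₁ x * w₂ x) volume
  simp only [hw.odd₁ _, hw.even₂ _, neg_mul, integral_neg] at h
  exact self_eq_neg.1 h.symm

theorem integral_sq_ne_zero {w : ℝ → ℂ} (hw : MemLp w 2 volume) (hc : Continuous w)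
    (hr : ∀ x, (w x).im = 0) (h0 : w ≠ 0) : ∫ x, w x * w x ≠ 0 := by
  intro h
  have hae := hw.coeFn_toLp
  have h1 : inner ℂ (hw.toLp w) (hw.toLp w) = 0 := by
    rw [inner_eq_integral hae hae, ← h]
    exact integral_congr_ae (Eventually.of_forall fun x => by simp only [conj_eq_of_real hr])
  rw [inner_self_eq_zero] at h1
  rw [h1] at hae
  exact h0 ((hc.ae_eq_iff_eq volume continuous_const).1
    (hae.symm.trans (Lp.coeFn_zero _ _ _)))

theorem exists_boundaryValues_eq (hw : IsFundamentalPair q w₁ w₂) (a₁ a₂ b₁ b₂ : ℂ) :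
    ∃ y, InDmax q y ∧ HasBoundaryValues w₁ w₂ y a₁ a₂ b₁ b₂ := by
  have hW := hw.wronskian 0
  have h1 : ∫ x, w₁ x * w₁ x ≠ 0 := integral_sq_ne_zero hw.dmax₁.memLp
    hw.dmax₁.regular.ac.continuous hw.real₁ (by
      rintro rfl
      have h : deriv (0 : ℝ → ℂ) 0 = 0 := deriv_const 0 (0 : ℂ)
      simp [h] at hW)
  have h2 : ∫ x, w₂ x * w₂ x ≠ 0 := integral_sq_ne_zero hw.dmax₂.memLp
    hw.dmax₂.regular.ac.continuous hw.real₂ (by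
      rintro rfl
      have h : deriv (0 : ℝ → ℂ) 0 = 0 := deriv_const 0 (0 : ℂ)
      simp [h] at hW)
  -- Take `u = s₁ w₁ + s₂ w₂` as right-hand side. The values at `+∞` are `a_j - ∫ w_j u`, and by
  -- orthogonality of `w₁, w₂` the equations `∫ w_j u = a_j - b_j` decouple.
  set s₁ := (a₁ - b₁) / ∫ x, w₁ x * w₁ x with hs₁
  set s₂ := (a₂ - b₂) / ∫ x, w₂ x * w₂ x with hs₂
  have hm₁ := hw.dmax₁.memLp
  have hm₂ := hw.dmax₂.memLp
  obtain ⟨y, hy, -, hb⟩ := hw.exists_tau_eq ((hm₁.const_smul s₁).add (hm₂.const_smul s₂)) a₁ a₂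
  have h12 : ∫ x, w₂ x * w₁ x = 0 := by
    simp only [mul_comm (w₂ _), hw.integral_mul_eq_zero]
  have hI : ∀ {w : ℝ → ℂ}, MemLp w 2 volume →
      ∫ x, w x * (s₁ • w₁ + s₂ • w₂) x = s₁ * (∫ x, w x * w₁ x) + s₂ * ∫ x, w x * w₂ x := by
    intro w hm
    have e₁ : Integrable fun x => s₁ * (w x * w₁ x) := (hm.integrable_mul hm₁).const_mul s₁
    have e₂ : Integrable fun x => s₂ * (w x * w₂ x) := (hm.integrable_mul hm₂).const_mul s₂
    rw [← integral_const_mul, ← integral_const_mul, ← integral_add e₁ e₂]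
    refine integral_congr_ae (Eventually.of_forall fun x => ?_)
    simp only [Pi.add_apply, Pi.smul_apply, smul_eq_mul]
    ring
  rw [hI hm₁, hI hm₂, h12, hw.integral_mul_eq_zero, hs₁, hs₂, mul_zero, mul_zero, add_zero,
    zero_add, div_mul_cancel₀ _ h1, div_mul_cancel₀ _ h2, sub_sub_cancel, sub_sub_cancel] at hb
  exact ⟨y, hy, hb⟩

/-! ### The adjoint of the minimal operator -/

theorem integral_conj_tau_mul (hw : IsFundamentalPair q w₁ w₂) {f g : ℝ → ℂ} (hf : InDmax q f)
    (hg : InDmax q g) (hbg : HasBoundaryValues w₁ w₂ g 0 0 0 0) :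
    ∫ x, conj (tau q f x) * g x = ∫ x, conj (f x) * tau q g x := by
  obtain ⟨a₁, a₂, b₁, b₂, hbf⟩ := hw.exists_boundaryValues hf
  have h := hw.green hf hg hbf hbg
  simpa [sub_eq_zero] using h

/-- Solve `τ_q z = h`. Every `u` orthogonal to `w₁, w₂` is `τ_q y` for some `y` with zero boundary
values, so `⟨v, u⟩ = ⟨h, y⟩ = ⟨τ_q z, y⟩ = ⟨z, u⟩`. Thus `v - z` lies in the double orthogonal
complement of `{w₁, w₂}`, which is their span by finite dimensionality, and `τ_q` kills this span.
-/
theorem exists_inDmax_of_forall_inner (hw : IsFundamentalPair q w₁ w₂) {v h : L2}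
    (H : ∀ (y : ℝ → ℂ) (hy : InDmax q y), HasBoundaryValues w₁ w₂ y 0 0 0 0 →
      inner ℂ h (hy.memLp.toLp y) = inner ℂ v (hy.memLp_tau.toLp (tau q y))) :
    ∃ y, InDmax q y ∧ v =ᵐ[volume] y ∧ h =ᵐ[volume] tau q y := by
  obtain ⟨z, hz, hzt, -⟩ := hw.exists_tau_eq (Lp.memLp h) 0 0
  set W₁ : L2 := hw.dmax₁.memLp.toLp w₁
  set W₂ : L2 := hw.dmax₂.memLp.toLp w₂
  have hW₁ : W₁ =ᵐ[volume] w₁ := hw.dmax₁.memLp.coeFn_toLp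
  have hW₂ : W₂ =ᵐ[volume] w₂ := hw.dmax₂.memLp.coeFn_toLp
  set Z : L2 := hz.memLp.toLp z
  have hZ : Z =ᵐ[volume] z := hz.memLp.coeFn_toLp
  have hmem : v - Z ∈ (Submodule.span ℂ {W₁, W₂})ᗮᗮ := by
    rw [Submodule.mem_orthogonal']
    intro u hu
    have hu₁ : ∫ x, w₁ x * u x = 0 := by
      have h1 := hu W₁ (Submodule.subset_span (by simp))
      rw [inner_eq_integral hW₁ (ae_eq_refl _)] at h1
      simpa only [conj_eq_of_real hw.real₁] using h1
    have hu₂ : ∫ x, w₂ x * u x = 0 := by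
      have h1 := hu W₂ (Submodule.subset_span (by simp))
      rw [inner_eq_integral hW₂ (ae_eq_refl _)] at h1
      simpa only [conj_eq_of_real hw.real₂] using h1
    obtain ⟨y, hy, hyt, hb⟩ := hw.exists_tau_eq (Lp.memLp u) 0 0
    rw [hu₁, hu₂, sub_zero] at hb
    have h1 := H y hy hb
    have h2 := hw.integral_conj_tau_mul hz hy hb
    have hyu : hy.memLp_tau.toLp (tau q y) = u :=
      Lp.ext (hy.memLp_tau.coeFn_toLp.trans hyt)
    rw [hyu, inner_eq_integral hzt.symm hy.memLp.coeFn_toLp, h2,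
      ← inner_eq_integral hZ hyt.symm] at h1
    rw [inner_sub_left, h1, sub_self]
  have : FiniteDimensional ℂ (Submodule.span ℂ {W₁, W₂}) :=
    FiniteDimensional.span_of_finite ℂ (Set.toFinite _)
  rw [Submodule.orthogonal_orthogonal, Submodule.mem_span_pair] at hmem
  obtain ⟨c₁, c₂, hc⟩ := hmem
  have hv : v = Z + (c₁ • W₁ + c₂ • W₂) := by rw [hc]; abel
  have hd := (hw.dmax₁.smul c₁).add (hw.dmax₂.smul c₂)
  refine ⟨z + (c₁ • w₁ + c₂ • w₂), hz.add hd, ?_, ?_⟩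
  · rw [hv]
    exact (Lp.coeFn_add _ _).trans (hZ.add ((Lp.coeFn_add _ _).trans
      (((Lp.coeFn_smul c₁ W₁).trans (hW₁.const_smul c₁)).add
        ((Lp.coeFn_smul c₂ W₂).trans (hW₂.const_smul c₂)))))
  · filter_upwards [hzt, tau_add hz.regular hd.regular,
      tau_add (q := q) (hw.dmax₁.smul c₁).regular (hw.dmax₂.smul c₂).regular,
      tau_smul (q := q) c₁ hw.dmax₁.regular, tau_smul (q := q) c₂ hw.dmax₂.regular,
      hw.sol₁.tau_ae_eq_zero, hw.sol₂.tau_ae_eq_zero] with x e1 e2 e3 e4 e5 e6 e7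
    rw [e2, Pi.add_apply, e3, Pi.add_apply, e4, e5, e1, Pi.smul_apply, Pi.smul_apply, e6, e7]
    simp

end IsFundamentalPair

/-! ### Separated extensions and their adjoints -/

theorem separatedExtension_ae {q : ℝ → ℝ} {w₁ w₂ : ℝ → ℂ} {ξ η : ℂ} {α β : ℝ}
    (f : (separatedExtension q w₁ w₂ ξ η α β).domain) {y : ℝ → ℂ} (hy : InDmax q y)
    (h : (f : L2) =ᵐ[volume] y) :
    separatedExtension q w₁ w₂ ξ η α β f =ᵐ[volume] tau q y := by
  have h1 : separatedExtension q w₁ w₂ ξ η α β f = maxOperator q ⟨f, f.2.2⟩ :=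
    LinearPMap.domRestrict_apply rfl
  rw [h1]
  exact maxOperator_ae _ hy h

/-- The boundary conditions, in terms of the boundary values. -/
def SatisfiesBC (ξ η : ℂ) (α β : ℝ) (a₁ a₂ b₁ b₂ : ℂ) : Prop :=
  a₁ * ξ * (Real.cos α : ℂ) - a₂ * (Real.sin α : ℂ) = 0 ∧
    b₁ * η * (Real.cos β : ℂ) - b₂ * (Real.sin β : ℂ) = 0

theorem mem_separatedExtension_domain_iff {q : ℝ → ℝ} {w₁ w₂ : ℝ → ℂ} {ξ η : ℂ} {α β : ℝ}
    {f : L2} {y : ℝ → ℂ} (hy : InDmax q y) (hf : f =ᵐ[volume] y) {a₁ a₂ b₁ b₂ : ℂ}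
    (hb : HasBoundaryValues w₁ w₂ y a₁ a₂ b₁ b₂) :
    f ∈ (separatedExtension q w₁ w₂ ξ η α β).domain ↔ SatisfiesBC ξ η α β a₁ a₂ b₁ b₂ := by
  rw [mem_separatedExtension_domain]
  constructor
  · rintro ⟨z, hz, hfz, c₁, c₂, d₁, d₂, hc, hbc⟩
    obtain rfl : y = z := hy.regular.eq_of_ae_eq hz.regular (hf.symm.trans hfz)
    obtain ⟨rfl, rfl, rfl, rfl⟩ := hb.unique hc
    exact hbc
  · exact fun h => ⟨y, hy, hf, a₁, a₂, b₁, b₂, hb, h⟩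

theorem exists_of_mem_separatedExtension_domain {q : ℝ → ℝ} {w₁ w₂ : ℝ → ℂ} {ξ η : ℂ} {α β : ℝ}
    {f : L2} (h : f ∈ (separatedExtension q w₁ w₂ ξ η α β).domain) :
    ∃ y a₁ a₂ b₁ b₂, InDmax q y ∧ f =ᵐ[volume] y ∧ HasBoundaryValues w₁ w₂ y a₁ a₂ b₁ b₂ ∧
      SatisfiesBC ξ η α β a₁ a₂ b₁ b₂ := by
  obtain ⟨y, hy, hf, a₁, a₂, b₁, b₂, hb, hbc⟩ := mem_separatedExtension_domain.1 h
  exact ⟨y, a₁, a₂, b₁, b₂, hy, hf, hb, hbc⟩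

theorem separatedExtension_congr {q : ℝ → ℝ} {w₁ w₂ : ℝ → ℂ} {ξ η ξ' η' : ℂ} {α β α' β' : ℝ}
    (h : ∀ a₁ a₂ b₁ b₂, SatisfiesBC ξ η α β a₁ a₂ b₁ b₂ ↔ SatisfiesBC ξ' η' α' β' a₁ a₂ b₁ b₂) :
    separatedExtension q w₁ w₂ ξ η α β = separatedExtension q w₁ w₂ ξ' η' α' β' := by
  have h1 : separatedDomain q w₁ w₂ ξ η α β = separatedDomain q w₁ w₂ ξ' η' α' β' := by
    ext f
    constructor
    · rintro ⟨y, hy, hf, a₁, a₂, b₁, b₂, hb, hbc⟩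
      exact ⟨y, hy, hf, a₁, a₂, b₁, b₂, hb, (h _ _ _ _).1 hbc⟩
    · rintro ⟨y, hy, hf, a₁, a₂, b₁, b₂, hb, hbc⟩
      exact ⟨y, hy, hf, a₁, a₂, b₁, b₂, hb, (h _ _ _ _).2 hbc⟩
  rw [separatedExtension, separatedExtension, h1]

/-- The boundary form vanishes on vectors satisfying a condition and its conjugate. -/
theorem boundaryForm_eq_zero {ξ a₁ a₂ c₁ c₂ : ℂ} {α : ℝ} (hξ : ‖ξ‖ = 1)
    (h : a₁ * ξ * (Real.cos α : ℂ) - a₂ * (Real.sin α : ℂ) = 0)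
    (h' : c₁ * conj ξ * (Real.cos α : ℂ) - c₂ * (Real.sin α : ℂ) = 0) :
    conj a₁ * c₂ - conj a₂ * c₁ = 0 := by
  have h1 := congrArg conj h
  simp only [map_sub, map_mul, Complex.conj_ofReal, map_zero] at h1
  -- `(conj a₁, conj a₂)` and `(c₁, c₂)` lie in the kernel of the same nonzero functional, so their
  -- determinant vanishes. Eliminating gives `sin α` and `cos α` times it, which cannot both lose
  -- information.
  have hs : (Real.sin α : ℂ) * (conj a₁ * c₂ - conj a₂ * c₁) = 0 := by
    linear_combination c₁ * h1 - conj a₁ * h'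
  have hc : conj ξ * ((Real.cos α : ℂ) * (conj a₁ * c₂ - conj a₂ * c₁)) = 0 := by
    linear_combination c₂ * h1 - conj a₂ * h'
  have hξ0 : conj ξ ≠ 0 := by
    rw [Ne, map_eq_zero]
    rintro rfl
    simp at hξ
  have hc' := (mul_eq_zero.1 hc).resolve_left hξ0
  have hsc : (Real.sin α : ℂ) * Real.sin α + (Real.cos α : ℂ) * Real.cos α = 1 := by
    have := Real.sin_sq_add_cos_sq α
    rw [sq, sq] at this
    exact_mod_cast this
  linear_combination (Real.sin α : ℂ) * hs + (Real.cos α : ℂ) * hc' -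
    (conj a₁ * c₂ - conj a₂ * c₁) * hsc

namespace IsFundamentalPair

variable {q : ℝ → ℝ} {w₁ w₂ : ℝ → ℂ}

theorem mem_domain_of_zero_boundaryValues {f : L2} {y : ℝ → ℂ} (ξ η : ℂ) (α β : ℝ)
    (hy : InDmax q y) (hf : f =ᵐ[volume] y) (hb : HasBoundaryValues w₁ w₂ y 0 0 0 0) :
    f ∈ (separatedExtension q w₁ w₂ ξ η α β).domain :=
  (mem_separatedExtension_domain_iff hy hf hb).2 ⟨by simp, by simp⟩

theorem dense_domain (hw : IsFundamentalPair q w₁ w₂) (ξ η : ℂ) (α β : ℝ) :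
    Dense ((separatedExtension q w₁ w₂ ξ η α β).domain : Set L2) := by
  rw [Submodule.dense_iff_topologicalClosure_eq_top, Submodule.topologicalClosure_eq_top_iff,
    Submodule.eq_bot_iff]
  intro h hh
  -- A vector `h` orthogonal to the domain satisfies the adjoint relation with `v = 0`, so `h = τ_q
  -- 0 = 0`.
  obtain ⟨y, hy, hv, ht⟩ := hw.exists_inDmax_of_forall_inner (v := 0) (h := h) fun y hy hb => by
    rw [inner_zero_left]
    exact (Submodule.mem_orthogonal' _ _).1 hh _
      (mem_domain_of_zero_boundaryValues ξ η α β hy hy.memLp.coeFn_toLp hb)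
  obtain rfl : y = 0 := hy.regular.eq_of_ae_eq (inDmax_zero q).regular
    (hv.symm.trans (Lp.coeFn_zero _ _ _))
  refine Lp.ext (ht.trans (EventuallyEq.trans ?_ (Lp.coeFn_zero _ _ _).symm))
  have h0 : deriv (0 : ℝ → ℂ) = 0 := funext fun x => deriv_const x (0 : ℂ)
  refine Eventually.of_forall fun x => ?_
  simp only [tau, h0]
  simp

/-- The adjoint of a separated extension is the separated extension with the conjugate
parameters. -/
theorem adjoint_separatedExtension (hw : IsFundamentalPair q w₁ w₂) {ξ η : ℂ} (hξ : ‖ξ‖ = 1)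
    (hη : ‖η‖ = 1) (α β : ℝ) :
    (separatedExtension q w₁ w₂ ξ η α β).adjoint =
      separatedExtension q w₁ w₂ (conj ξ) (conj η) α β := by
  have hd := hw.dense_domain ξ η α β
  have hle : separatedExtension q w₁ w₂ (conj ξ) (conj η) α β ≤
      (separatedExtension q w₁ w₂ ξ η α β).adjoint := by
    refine LinearPMap.IsFormalAdjoint.le_adjoint hd fun f g => ?_
    obtain ⟨y, a₁, a₂, b₁, b₂, hy, hf, hb, h1, h2⟩ :=
      exists_of_mem_separatedExtension_domain f.2
    obtain ⟨z, c₁, c₂, d₁, d₂, hz, hg, hb', h1', h2'⟩ :=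
      exists_of_mem_separatedExtension_domain g.2
    have h := hw.green hy hz hb hb'
    rw [boundaryForm_eq_zero hξ h1 h1', boundaryForm_eq_zero hη h2 h2', sub_zero,
      sub_eq_zero] at h
    rw [inner_eq_integral (separatedExtension_ae f hy hf) hg,
      inner_eq_integral hf (separatedExtension_ae g hz hg), h]
  refine (LinearPMap.eq_of_le_of_domain_eq hle (le_antisymm hle.1 fun v hv => ?_)).symm
  have hadj := LinearPMap.adjoint_isFormalAdjoint hd ⟨v, hv⟩
  set h := (separatedExtension q w₁ w₂ ξ η α β).adjoint ⟨v, hv⟩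
  -- Functions with zero boundary values lie in every separated domain; testing against them alone
  -- places `v` in the maximal domain.
  obtain ⟨y, hy, hvy, hhy⟩ := hw.exists_inDmax_of_forall_inner (v := v) (h := h)
    fun z hz hb => by
      have hmem := mem_domain_of_zero_boundaryValues ξ η α β hz hz.memLp.coeFn_toLp hb
      have h1 := hadj ⟨_, hmem⟩
      rw [h1]
      congr 1
      exact Lp.ext ((separatedExtension_ae ⟨_, hmem⟩ hz hz.memLp.coeFn_toLp).trans
        hz.memLp_tau.coeFn_toLp.symm)
  obtain ⟨a₁, a₂, b₁, b₂, hb⟩ := hw.exists_boundaryValues hy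
  have hform : ∀ c₁ c₂ d₁ d₂, SatisfiesBC ξ η α β c₁ c₂ d₁ d₂ →
      (conj b₁ * d₂ - conj b₂ * d₁) - (conj a₁ * c₂ - conj a₂ * c₁) = 0 := by
    intro c₁ c₂ d₁ d₂ hc
    obtain ⟨z, hz, hbz⟩ := hw.exists_boundaryValues_eq c₁ c₂ d₁ d₂
    have hmem := (mem_separatedExtension_domain_iff hz hz.memLp.coeFn_toLp hbz).2 hc
    have h1 := hadj ⟨_, hmem⟩
    rw [inner_eq_integral hhy hz.memLp.coeFn_toLp, inner_eq_integral hvy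
      (separatedExtension_ae ⟨_, hmem⟩ hz hz.memLp.coeFn_toLp)] at h1
    rw [← hw.green hy hz hb hbz, h1, sub_self]
  refine (mem_separatedExtension_domain_iff hy hvy hb).2 ⟨?_, ?_⟩
  -- `(sin α, ξ cos α)` spans the line of data allowed at `-∞`; zero data at the other end isolates
  -- one condition.
  · have h1 := congrArg conj (hform (Real.sin α) (ξ * Real.cos α) 0 0 ⟨by ring, by ring⟩)
    simp only [map_sub, map_mul, Complex.conj_ofReal, map_zero, Complex.conj_conj] at h1
    linear_combination -h1
  · have h1 := congrArg conj (hform 0 0 (Real.sin β) (η * Real.cos β) ⟨by ring, by ring⟩)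
    simp only [map_sub, map_mul, Complex.conj_ofReal, map_zero, Complex.conj_conj] at h1
    linear_combination h1

theorem isClosedDense_separatedExtension (hw : IsFundamentalPair q w₁ w₂) {ξ η : ℂ}
    (hξ : ‖ξ‖ = 1) (hη : ‖η‖ = 1) (α β : ℝ) :
    IsClosedDense (separatedExtension q w₁ w₂ ξ η α β) := by
  refine ⟨?_, hw.dense_domain _ _ _ _⟩
  -- The extension is itself an adjoint, namely of the one with conjugate parameters, hence closed.
  have h := LinearPMap.adjoint_isClosed (hw.dense_domain (conj ξ) (conj η) α β)
  rwa [hw.adjoint_separatedExtension (by simpa using hξ) (by simpa using hη),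
    Complex.conj_conj, Complex.conj_conj] at h

end IsFundamentalPair

/-! ### Parity and time reversal -/

theorem deriv_reflect (y : ℝ → ℂ) : deriv (fun x => y (-x)) = fun x => -deriv y (-x) :=
  funext fun x => deriv_comp_neg y x

theorem tau_reflect {q : ℝ → ℝ} (hq : Function.Even q) (y : ℝ → ℂ) (x : ℝ) :
    tau q (fun x => y (-x)) x = tau q y (-x) := by
  have h : deriv (fun x => -deriv y (-x)) x = deriv (deriv y) (-x) := by
    rw [deriv.fun_neg, deriv_comp_neg, neg_neg]
  simp only [tau, deriv_reflect, h, hq x]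

theorem deriv_conj (y : ℝ → ℂ) : deriv (fun x => conj (y x)) = fun x => conj (deriv y x) :=
  funext fun _ => deriv.star

theorem tau_conj (q : ℝ → ℝ) (y : ℝ → ℂ) (x : ℝ) :
    tau q (fun x => conj (y x)) x = conj (tau q y x) := by
  simp only [tau, deriv_conj, map_sub, map_neg, map_mul, Complex.conj_ofReal]

theorem InDmax.reflect {q : ℝ → ℝ} (hq : Function.Even q) {y : ℝ → ℂ} (hy : InDmax q y) :
    InDmax q fun x => y (-x) where
  regular :=
    { differentiable := hy.regular.differentiable.comp differentiable_neg
      ac := hy.regular.ac.comp_neg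
      ac_deriv := by
        rw [deriv_reflect]
        exact fun a b => (hy.regular.ac_deriv.comp_neg a b).fun_neg }
  memLp := hy.memLp.comp_measurePreserving (Measure.measurePreserving_neg volume)
  memLp_tau := by
    rw [funext (tau_reflect hq y)]
    exact hy.memLp_tau.comp_measurePreserving (Measure.measurePreserving_neg volume)

theorem InDmax.conj {q : ℝ → ℝ} {y : ℝ → ℂ} (hy : InDmax q y) :
    InDmax q fun x => conj (y x) where
  regular :=
    { differentiable := fun x =>
        (hasDerivAt_conj (hy.regular.differentiable x).hasDerivAt).differentiableAt
      ac := hy.regular.ac.conj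
      ac_deriv := by
        rw [deriv_conj]
        exact hy.regular.ac_deriv.conj }
  memLp := memLp_conj hy.memLp
  memLp_tau := by
    rw [funext (tau_conj q y)]
    exact memLp_conj hy.memLp_tau

theorem parity_ae_of_ae {f : L2} {y : ℝ → ℂ} (h : f =ᵐ[volume] y) :
    parity f =ᵐ[volume] fun x => y (-x) :=
  (parity_ae f).trans
    ((Measure.measurePreserving_neg volume).quasiMeasurePreserving.ae_eq_comp h)

theorem timeReversal_ae_of_ae {f : L2} {y : ℝ → ℂ} (h : f =ᵐ[volume] y) :
    timeReversal f =ᵐ[volume] fun x => conj (y x) := by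
  filter_upwards [timeReversal_ae f, h] with x h1 h2
  rw [h1, h2]

namespace IsFundamentalPair

variable {q : ℝ → ℝ} {w₁ w₂ : ℝ → ℂ}

/-- Reflection reverses the sign of derivatives. With `w₁` odd a second sign cancels this in `[w₁,
·]`; with `w₂` even it survives. -/
theorem boundaryValues_reflect (hw : IsFundamentalPair q w₁ w₂) {y : ℝ → ℂ} {a₁ a₂ b₁ b₂ : ℂ}
    (hb : HasBoundaryValues w₁ w₂ y a₁ a₂ b₁ b₂) :
    HasBoundaryValues w₁ w₂ (fun x => y (-x)) b₁ (-b₂) a₁ (-a₂) := by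
  have h1 : bracket w₁ (fun x => y (-x)) = fun x => bracket w₁ y (-x) := by
    funext x
    have h := congrFun (deriv_reflect w₁) x
    simp only [hw.odd₁ _, deriv.fun_neg, neg_inj] at h
    rw [hw.bracket₁, hw.bracket₁, deriv_reflect, hw.odd₁, ← h]
    ring
  have h2 : bracket w₂ (fun x => y (-x)) = fun x => -bracket w₂ y (-x) := by
    funext x
    have h := congrFun (deriv_reflect w₂) x
    simp only [hw.even₂ _] at h
    rw [hw.bracket₂, hw.bracket₂, deriv_reflect, hw.even₂, h]
    ring
  refine ⟨?_, ?_, ?_, ?_⟩ <;> simp only [h1, h2]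
  · exact hb.β₁.comp tendsto_neg_atBot_atTop
  · exact (hb.β₂.comp tendsto_neg_atBot_atTop).neg
  · exact hb.α₁.comp tendsto_neg_atTop_atBot
  · exact (hb.α₂.comp tendsto_neg_atTop_atBot).neg

theorem boundaryValues_conj (hw : IsFundamentalPair q w₁ w₂) {y : ℝ → ℂ} {a₁ a₂ b₁ b₂ : ℂ}
    (hb : HasBoundaryValues w₁ w₂ y a₁ a₂ b₁ b₂) :
    HasBoundaryValues w₁ w₂ (fun x => conj (y x)) (conj a₁) (conj a₂) (conj b₁) (conj b₂) := by
  have h1 : bracket w₁ (fun x => conj (y x)) = fun x => conj (bracket w₁ y x) := by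
    funext x
    simp only [hw.bracket₁, deriv_conj, map_sub, map_mul, conj_eq_of_real hw.real₁,
      hw.dmax₁.regular.conj_deriv_of_real hw.real₁]
  have h2 : bracket w₂ (fun x => conj (y x)) = fun x => conj (bracket w₂ y x) := by
    funext x
    simp only [hw.bracket₂, deriv_conj, map_sub, map_mul, conj_eq_of_real hw.real₂,
      hw.dmax₂.regular.conj_deriv_of_real hw.real₂]
  have hc : ∀ {l : Filter ℝ} {u : ℝ → ℂ} {a : ℂ}, Tendsto u l (𝓝 a) →
      Tendsto (fun x => conj (u x)) l (𝓝 (conj a)) :=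
    fun hu => (Complex.continuous_conj.tendsto _).comp hu
  refine ⟨?_, ?_, ?_, ?_⟩ <;> simp only [h1, h2]
  exacts [hc hb.α₁, hc hb.α₂, hc hb.β₁, hc hb.β₂]

end IsFundamentalPair

/-! ### Symmetry properties of separated extensions -/

namespace IsFundamentalPair

variable {q : ℝ → ℝ} {w₁ w₂ : ℝ → ℂ}

/-- Data spanning the allowed lines must also satisfy the adjoint's conditions, those with `conj ξ`
and `conj η`. -/
theorem parameters_of_isSelfAdjoint (hw : IsFundamentalPair q w₁ w₂) {ξ η : ℂ} (hξ : ‖ξ‖ = 1)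
    (hη : ‖η‖ = 1) {α β : ℝ} (h : IsSelfAdjoint (separatedExtension q w₁ w₂ ξ η α β)) :
    (conj ξ - ξ) * (Real.sin α * Real.cos α : ℝ) = 0 ∧
      (conj η - η) * (Real.sin β * Real.cos β : ℝ) = 0 := by
  rw [LinearPMap.isSelfAdjoint_def, hw.adjoint_separatedExtension hξ hη] at h
  obtain ⟨y, hy, hb⟩ := hw.exists_boundaryValues_eq (Real.sin α) (ξ * Real.cos α)
    (Real.sin β) (η * Real.cos β)
  have hmem := (mem_separatedExtension_domain_iff (ξ := ξ) (η := η) (α := α) (β := β) hy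
    hy.memLp.coeFn_toLp hb).2 ⟨by ring, by ring⟩
  rw [← h] at hmem
  obtain ⟨h1, h2⟩ := (mem_separatedExtension_domain_iff hy hy.memLp.coeFn_toLp hb).1 hmem
  push_cast at h1 h2 ⊢
  exact ⟨by linear_combination h1, by linear_combination h2⟩

theorem sin_add_eq_zero_of_isPTSymmetric (hw : IsFundamentalPair q w₁ w₂)
    (hq : Function.Even q) {α β : ℝ}
    (h : IsPTSymmetric (separatedExtension q w₁ w₂ 1 1 α β)) : Real.sin (α + β) = 0 := by
  -- The data sit only at `+∞`; `PT` carries them to `(sin β, -cos β)` at `-∞`, where the condition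
  -- with `α` reads `sin (α + β) = 0`.
  obtain ⟨y, hy, hb⟩ := hw.exists_boundaryValues_eq 0 0 (Real.sin β) (Real.cos β)
  have hmem := (mem_separatedExtension_domain_iff (ξ := 1) (η := 1) (α := α) (β := β) hy
    hy.memLp.coeFn_toLp hb).2 ⟨by ring, by ring⟩
  obtain ⟨hPT, -⟩ := h.comm ⟨_, hmem⟩
  obtain ⟨h1, -⟩ := (mem_separatedExtension_domain_iff (hy.conj.reflect hq)
    (parity_ae_of_ae (timeReversal_ae_of_ae hy.memLp.coeFn_toLp))
    (hw.boundaryValues_reflect (hw.boundaryValues_conj hb))).1 hPT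
  rw [Complex.conj_ofReal, Complex.conj_ofReal] at h1
  have h2 : Real.sin β * 1 * Real.cos α - -Real.cos β * Real.sin α = 0 := by exact_mod_cast h1
  rw [Real.sin_add]
  linarith

theorem satisfiesBC_swap {α β : ℝ} (h : Real.sin (α + β) = 0) {a₁ a₂ b₁ b₂ : ℂ}
    (hbc : SatisfiesBC 1 1 α β a₁ a₂ b₁ b₂) : SatisfiesBC 1 1 α β b₁ (-b₂) a₁ (-a₂) := by
  have hs : (Real.sin α : ℂ) * Real.cos β + Real.cos α * Real.sin β = 0 := by
    rw [Real.sin_add] at h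
    exact_mod_cast h
  have hα : (Real.sin α : ℂ) * Real.sin α + Real.cos α * Real.cos α = 1 := by
    have := Real.sin_sq_add_cos_sq α
    rw [sq, sq] at this
    exact_mod_cast this
  have hβ : (Real.sin β : ℂ) * Real.sin β + Real.cos β * Real.cos β = 1 := by
    have := Real.sin_sq_add_cos_sq β
    rw [sq, sq] at this
    exact_mod_cast this
  obtain ⟨h1, h2⟩ := hbc
  constructor
  -- The first coefficient is `cos (α + β)`: when `sin (α + β) = 0`, one has `(cos α, sin α) = cos
  -- (α + β) · (cos β, -sin β)`.
  · linear_combination (Real.cos α * Real.cos β - Real.sin α * Real.sin β : ℂ) * h2 - (b₁ * Real.cos α + b₂ * Real.sin α) * hβ +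
      (b₁ * Real.sin β + b₂ * Real.cos β) * hs
  · linear_combination (Real.cos α * Real.cos β - Real.sin α * Real.sin β : ℂ) * h1 - (a₁ * Real.cos β + a₂ * Real.sin β) * hα +
      (a₁ * Real.sin α + a₂ * Real.cos α) * hs

theorem isSelfAdjoint_one (hw : IsFundamentalPair q w₁ w₂) (α β : ℝ) :
    IsSelfAdjoint (separatedExtension q w₁ w₂ 1 1 α β) := by
  rw [LinearPMap.isSelfAdjoint_def, hw.adjoint_separatedExtension norm_one norm_one, map_one]

theorem isPTSymmetric_one (hw : IsFundamentalPair q w₁ w₂) (hq : Function.Even q) {α β : ℝ}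
    (h : Real.sin (α + β) = 0) : IsPTSymmetric (separatedExtension q w₁ w₂ 1 1 α β) where
  toIsClosedDense := hw.isClosedDense_separatedExtension norm_one norm_one α β
  comm := by
    intro f
    obtain ⟨y, a₁, a₂, b₁, b₂, hy, hf, hb, hbc⟩ := exists_of_mem_separatedExtension_domain f.2
    have hf' := parity_ae_of_ae (timeReversal_ae_of_ae hf)
    have hbc' : SatisfiesBC 1 1 α β (conj a₁) (conj a₂) (conj b₁) (conj b₂) := by
      have h1 := congrArg conj hbc.1
      have h2 := congrArg conj hbc.2
      simp only [map_sub, map_mul, Complex.conj_ofReal, map_zero, map_one] at h1 h2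
      exact ⟨h1, h2⟩
    refine ⟨(mem_separatedExtension_domain_iff (hy.conj.reflect hq) hf'
      (hw.boundaryValues_reflect (hw.boundaryValues_conj hb))).2 (satisfiesBC_swap h hbc'), ?_⟩
    refine Lp.ext ((parity_ae_of_ae (timeReversal_ae_of_ae
      (separatedExtension_ae f hy hf))).trans (EventuallyEq.trans ?_
        (separatedExtension_ae _ (hy.conj.reflect hq) hf').symm))
    refine Eventually.of_forall fun x => ?_
    simp only [tau_reflect hq (fun x => conj (y x)), tau_conj]

theorem parity_mem_domain_one (hw : IsFundamentalPair q w₁ w₂) (hq : Function.Even q) {α β : ℝ}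
    (h : Real.sin (α + β) = 0) {f : L2}
    (hf : f ∈ (separatedExtension q w₁ w₂ 1 1 α β).domain) :
    parity f ∈ (separatedExtension q w₁ w₂ 1 1 α β).domain := by
  obtain ⟨y, a₁, a₂, b₁, b₂, hy, hf, hb, hbc⟩ := exists_of_mem_separatedExtension_domain hf
  exact (mem_separatedExtension_domain_iff (hy.reflect hq) (parity_ae_of_ae hf)
    (hw.boundaryValues_reflect hb)).2 (satisfiesBC_swap h hbc)

theorem parity_parity (f : L2) : parity (parity f) = f := by
  refine Lp.ext ((parity_ae_of_ae (parity_ae f)).trans (Eventually.of_forall fun x => ?_))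
  simp only [neg_neg]

/-- With `H* = H` the claim becomes `H = P H P`. It holds because `P` is an involution preserving
the domain and `τ_q` commutes with reflection for even `q`. -/
theorem isPSelfAdjoint_one (hw : IsFundamentalPair q w₁ w₂) (hq : Function.Even q) {α β : ℝ}
    (h : Real.sin (α + β) = 0) : IsPSelfAdjoint (separatedExtension q w₁ w₂ 1 1 α β) where
  toIsClosedDense := hw.isClosedDense_separatedExtension norm_one norm_one α β
  mem_domain_iff := by
    intro f
    rw [LinearPMap.isSelfAdjoint_def.1 (hw.isSelfAdjoint_one α β)]
    refine ⟨hw.parity_mem_domain_one hq h, fun hf => ?_⟩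
    rw [← parity_parity f]
    exact hw.parity_mem_domain_one hq h hf
  apply_eq := by
    rw [LinearPMap.isSelfAdjoint_def.1 (hw.isSelfAdjoint_one α β)]
    intro f hPf
    obtain ⟨y, a₁, a₂, b₁, b₂, hy, hf, hb, hbc⟩ := exists_of_mem_separatedExtension_domain f.2
    refine Lp.ext ((separatedExtension_ae f hy hf).trans (EventuallyEq.trans ?_
      (parity_ae_of_ae (separatedExtension_ae ⟨_, hPf⟩ (hy.reflect hq)
        (parity_ae_of_ae hf))).symm))
    refine Eventually.of_forall fun x => ?_
    simp only [tau_reflect hq y, neg_neg]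

end IsFundamentalPair

/-! ### Normalized parameters -/

theorem isNormalized_one (α : ℝ) : IsNormalized 1 α :=
  ⟨by norm_num, fun _ => rfl⟩

/-- If `sin α cos α ≠ 0`, then `ξ` is real of modulus one, hence `±1`, and normalization excludes
`-1`. -/
theorem IsNormalized.eq_one {ξ : ℂ} {α : ℝ} (h : IsNormalized ξ α) (hξ : ‖ξ‖ = 1)
    (hr : (conj ξ - ξ) * (Real.sin α * Real.cos α : ℝ) = 0) : ξ = 1 := by
  rcases mul_eq_zero.1 hr with h1 | h1
  · have h2 : ξ * ξ = 1 := by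
      have h3 := Complex.mul_conj' ξ
      rw [sub_eq_zero.1 h1, hξ] at h3
      simpa using h3
    exact (mul_self_eq_one_iff.1 h2).resolve_right h.1
  · exact h.2 (by exact_mod_cast h1)

theorem exists_isNormalized {ξ : ℂ} (hξ : ‖ξ‖ = 1) {α : ℝ} (hα : α ∈ Set.Ico 0 (2 * Real.pi)) :
    ∃ (ξ' : ℂ) (α' : ℝ), ‖ξ'‖ = 1 ∧ α' ∈ Set.Ico 0 (2 * Real.pi) ∧ IsNormalized ξ' α' ∧
      ∀ a₁ a₂ : ℂ, a₁ * ξ * (Real.cos α : ℂ) - a₂ * (Real.sin α : ℂ) = 0 ↔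
        a₁ * ξ' * (Real.cos α' : ℂ) - a₂ * (Real.sin α' : ℂ) = 0 := by
  have hξ0 : ξ ≠ 0 := by
    rintro rfl
    simp at hξ
  by_cases h : Real.sin α * Real.cos α = 0
  · refine ⟨1, α, norm_one, hα, isNormalized_one α, fun a₁ a₂ => ?_⟩
    rcases mul_eq_zero.1 h with h1 | h1 <;> simp [h1, hξ0]
  · by_cases h1 : ξ = -1
    · have hα0 : α ≠ 0 := by
        rintro rfl
        simp at h
      have hpos := lt_of_le_of_ne hα.1 hα0.symm
      -- Replacing `α` by `-α` modulo `2π` absorbs the sign of `ξ = -1`; `α ≠ 0` keeps `2π - α`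
      -- below `2π`.
      refine ⟨1, 2 * Real.pi - α, norm_one, ⟨by linarith [hα.2], by linarith⟩,
        isNormalized_one _, fun a₁ a₂ => ?_⟩
      rw [Real.cos_two_pi_sub, Real.sin_two_pi_sub, h1, ← neg_eq_zero]
      push_cast
      ring_nf
    · exact ⟨ξ, α, hξ, hα, ⟨h1, fun h2 => absurd h2 h⟩, fun _ _ => Iff.rfl⟩

theorem IsFundamentalPair.symmetric_iff_of_isNormalized {q : ℝ → ℝ} {w₁ w₂ : ℝ → ℂ}
    (hw : IsFundamentalPair q w₁ w₂) (hq : Function.Even q) {ξ η : ℂ} (hξ : ‖ξ‖ = 1)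
    (hη : ‖η‖ = 1) {α β : ℝ} (hnα : IsNormalized ξ α) (hnβ : IsNormalized η β) :
    (IsPTSymmetric (separatedExtension q w₁ w₂ ξ η α β) ∧
      IsSelfAdjoint (separatedExtension q w₁ w₂ ξ η α β) ∧
      IsPSelfAdjoint (separatedExtension q w₁ w₂ ξ η α β)) ↔
      ξ = 1 ∧ η = 1 ∧ ∃ k : ℤ, α + β = k * Real.pi := by
  constructor
  · rintro ⟨hPT, hSA, -⟩
    obtain ⟨h1, h2⟩ := hw.parameters_of_isSelfAdjoint hξ hη hSA
    obtain rfl := hnα.eq_one hξ h1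
    obtain rfl := hnβ.eq_one hη h2
    obtain ⟨k, hk⟩ := Real.sin_eq_zero_iff.1 (hw.sin_add_eq_zero_of_isPTSymmetric hq hPT)
    exact ⟨rfl, rfl, k, hk.symm⟩
  · rintro ⟨rfl, rfl, k, hk⟩
    have h : Real.sin (α + β) = 0 := by rw [hk, Real.sin_int_mul_pi]
    exact ⟨hw.isPTSymmetric_one hq h, hw.isSelfAdjoint_one α β, hw.isPSelfAdjoint_one hq h⟩

end PTQM

theorem mainTheorem10
    (q : ℝ → ℝ) (hq : MeasureTheory.LocallyIntegrable q MeasureTheory.volume)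
    (hq_even : Function.Even q)
    (hq_top : PTQM.LimitCircleTop q) (hq_bot : PTQM.LimitCircleBot q)
    (w₁ w₂ : ℝ → ℂ) (hw : PTQM.IsFundamentalPair q w₁ w₂)
    (ξ η : ℂ) (hξ : ‖ξ‖ = 1) (hη : ‖η‖ = 1)
    (α β : ℝ) (hα : α ∈ Set.Ico 0 (2 * Real.pi)) (hβ : β ∈ Set.Ico 0 (2 * Real.pi)) :
    -- every separated boundary condition has normalized parameters
    (∃ (ξ' η' : ℂ) (α' β' : ℝ), ‖ξ'‖ = 1 ∧ ‖η'‖ = 1 ∧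
      α' ∈ Set.Ico 0 (2 * Real.pi) ∧ β' ∈ Set.Ico 0 (2 * Real.pi) ∧
      PTQM.IsNormalized ξ' α' ∧ PTQM.IsNormalized η' β' ∧
      PTQM.separatedExtension q w₁ w₂ ξ η α β = PTQM.separatedExtension q w₁ w₂ ξ' η' α' β') ∧
    -- the criterion in terms of normalized parameters
    (PTQM.IsNormalized ξ α → PTQM.IsNormalized η β →
      ((PTQM.IsPTSymmetric (PTQM.separatedExtension q w₁ w₂ ξ η α β) ∧
        IsSelfAdjoint (PTQM.separatedExtension q w₁ w₂ ξ η α β) ∧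
        PTQM.IsPSelfAdjoint (PTQM.separatedExtension q w₁ w₂ ξ η α β)) ↔
        ξ = 1 ∧ η = 1 ∧ ∃ k : ℤ, α + β = k * Real.pi)) ∧
    -- the criterion for arbitrary parameters
    ((PTQM.IsPTSymmetric (PTQM.separatedExtension q w₁ w₂ ξ η α β) ∧
        IsSelfAdjoint (PTQM.separatedExtension q w₁ w₂ ξ η α β) ∧
        PTQM.IsPSelfAdjoint (PTQM.separatedExtension q w₁ w₂ ξ η α β)) ↔
      ∃ α' ∈ Set.Ico 0 (2 * Real.pi), ∃ β' ∈ Set.Ico 0 (2 * Real.pi),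
        (∃ k : ℤ, α' + β' = k * Real.pi) ∧
        PTQM.separatedExtension q w₁ w₂ ξ η α β = PTQM.separatedExtension q w₁ w₂ 1 1 α' β') := by
  obtain ⟨ξ', α', hξ', hα', hnα, hα_iff⟩ := PTQM.exists_isNormalized hξ hα
  obtain ⟨η', β', hη', hβ', hnβ, hβ_iff⟩ := PTQM.exists_isNormalized hη hβ
  have heq : PTQM.separatedExtension q w₁ w₂ ξ η α β =
      PTQM.separatedExtension q w₁ w₂ ξ' η' α' β' :=
    PTQM.separatedExtension_congr fun a₁ a₂ b₁ b₂ => and_congr (hα_iff a₁ a₂) (hβ_iff b₁ b₂)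
  refine ⟨⟨ξ', η', α', β', hξ', hη', hα', hβ', hnα, hnβ, heq⟩,
    hw.symmetric_iff_of_isNormalized hq_even hξ hη, ?_⟩
  constructor
  · intro h
    -- The criterion is applied to the normalized parameters of the same operator; conversely, `ξ =
    -- 1` is normalized for every angle.
    rw [heq, hw.symmetric_iff_of_isNormalized hq_even hξ' hη' hnα hnβ] at h
    obtain ⟨rfl, rfl, hk⟩ := h
    exact ⟨α', hα', β', hβ', hk, heq⟩
  · rintro ⟨α'', -, β'', -, hk, h⟩
    rw [h, hw.symmetric_iff_of_isNormalized hq_even norm_one norm_one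
      (PTQM.isNormalized_one α'') (PTQM.isNormalized_one β'')]
    exact ⟨rfl, rfl, hk⟩
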